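/- Let $\mathcal X$ be a finite alphabet, $B$ a finite-dimensional quantum system, and $\rho_{XB}=\sum_{x\in\mathcal X}p(x)\,|x\rangle\langle x|\otimes\rho_B^x$ a classical-quantum state, where $p$ is a probability distribution and each $\rho_B^x$ is a density operator on $B$. All logarithms are to base $2$. For sequences $\mathbf x=(x_1,\dots,x_n)$ put $p(\mathbf x)=\prod_k p(x_k)$ and $\rho^{\mathbf x}_{B^n}=\rho_B^{x_1}\otimes\dots\otimes\rho_B^{x_n}$. For $n\in\mathbb N$, $n\ge 1$, and $R\ge 0$, an $(n,R)$-code $\mathcal C$ consists of a finite message set $\mathcal W$ with $|\mathcal W|\le 2^{nR}$, a (possibly random) encoder sending $\mathbf x\in\mathcal X^n$ to $w\in\mathcal W$ with probability $P(w|\mathbf x)$, and for every $w\in\mathcal W$ a POVM $\{\Pi^{(w)}_{\mathbf x}\}_{\mathbf x\in\mathcal X^n}$ on $B^n$. Its error probability is $$P_{\mathrm e}(\mathcal C)=1-\sum_{\mathbf x\in\mathcal X^n,\,w\in\mathcal W}P(w|\mathbf x)\,p(\mathbf x)\,\mathrm{Tr}\big[\Pi^{(w)}_{\mathbf x}\rho^{\mathbf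 x}_{B^n}\big].$$ Let $P^*_{\mathrm e}(n,R)$ be the infimum of $P_{\mathrm e}(\mathcal C)$ over all $(n,R)$-codes $\mathcal C$, and let $sc(n,R)=-\frac1n\log\big(1-P^*_{\mathrm e}(n,R)\big)$. Let $H(X|B)_\rho=H(\rho_{XB})-H(\rho_B)$ with the von Neumann entropy $H(\omega)=-\mathrm{Tr}(\omega\log\omega)$. For $\alpha>1$ let $$D^*_\alpha(\rho\|\sigma)=\frac1{\alpha-1}\log\mathrm{Tr}\Big[\big(\rho^{1/2}\sigma^{\frac{1-\alpha}{\alpha}}\rho^{1/2}\big)^\alpha\Big]$$ if $\mathrm{supp}\,\rho\subseteq\mathrm{supp}\,\sigma$ (powers are taken on the support), and $D^*_\alpha(\rho\|\sigma)=+\infty$ otherwise. Put $H^{*,\uparrow}_\alpha(X|B)_\rho=\sup_{\sigma_B}-D^*_\alpha(\rho_{XB}\|\mathbb 1_X\otimes\sigma_B)$, the supremum over all density operators $\sigma_B$ on $B$, and $$E^*_{\mathrm{sc}}(R)=\sup_{\alpha>1}\frac{1-\alpha}{\alpha}\Big(R-H^{*,\uparrow}_\alpha(X|B)_\rho\Big).$$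 Theorem. For all $0\le R<H(X|B)_\rho$ and all $n\ge1$, $$sc(n,R)\ \ge\ E^*_{\mathrm{sc}}(R)\ >\ 0 .$$ -/

import Mathlib

noncomputable section

namespace CQSW

open scoped Kronecker ComplexOrder

variable {A B X : Type*} [Fintype A] [DecidableEq A] [Fintype B] [DecidableEq B]
  [Fintype X] [DecidableEq X]

/-- A density matrix (quantum state) on the Hilbert space with orthonormal basis indexed by `A`. -/
def IsDensity (ρ : Matrix A A ℂ) : Prop :=
  ρ.PosSemidef ∧ ρ.trace = 1

/-- The power `M ^ s` of a positive semidefinite matrix, the sum of `a ^ s • P` over the nonzero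
eigenvalues `a` with eigenprojection `P` (kernel vectors are sent to zero, also for `s ≤ 0`). -/
def matPow (M : Matrix A A ℂ) (s : ℝ) : Matrix A A ℂ :=
  cfc (fun a : ℝ => if a = 0 then 0 else a ^ s) M

/-- The support of `ρ` is contained in the support of `σ` (for Hermitian matrices the support is
the orthogonal complement of the kernel). -/
def SuppLE (ρ σ : Matrix A A ℂ) : Prop :=
  LinearMap.ker σ.mulVecLin ≤ LinearMap.ker ρ.mulVecLin

/-- The von Neumann entropy `- Tr (ω log ω)`, with logarithm to base `2`. -/
def vnEntropy (ω : Matrix A A ℂ) : ℝ :=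
  (cfc (fun a : ℝ => -(a * Real.logb 2 a)) ω).trace.re

/-- The partial trace over the first factor. -/
def traceFst (ρ : Matrix (A × B) (A × B) ℂ) : Matrix B B ℂ :=
  Matrix.of fun i j => ∑ a, ρ (a, i) (a, j)

/-- The quantum conditional entropy `H(A|B) = H(AB) - H(B)`. -/
def condEntropy (ρ : Matrix (A × B) (A × B) ℂ) : ℝ :=
  vnEntropy ρ - vnEntropy (traceFst ρ)

/-- `Tr [(ρ ^ (1/2) σ ^ ((1-α)/α) ρ ^ (1/2)) ^ α]`. -/
def sandwichedQ (α : ℝ) (ρ σ : Matrix A A ℂ) : ℝ :=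
  (matPow (matPow ρ (1 / 2) * matPow σ ((1 - α) / α) * matPow ρ (1 / 2)) α).trace.re

open Classical in
/-- The sandwiched Rényi divergence of order `α > 1`, logarithm to base `2`; it is `+∞` unless
the support of `ρ` is contained in that of `σ`. -/
def sandwichedD (α : ℝ) (ρ σ : Matrix A A ℂ) : EReal :=
  if SuppLE ρ σ then ((1 / (α - 1) * Real.logb 2 (sandwichedQ α ρ σ) : ℝ) : EReal) else ⊤

/-- The sandwiched Rényi conditional entropy of order `α > 1`, optimized over the states `σ` of
the second system. -/
def sandwichedCondEntropy (α : ℝ) (ρ : Matrix (A × B) (A × B) ℂ) : EReal :=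
  ⨆ σ : {σ : Matrix B B ℂ // IsDensity σ},
    -sandwichedD α ρ ((1 : Matrix A A ℂ) ⊗ₖ (σ : Matrix B B ℂ))

/-- The data of a classical-quantum state: a probability distribution on the finite alphabet `X`
and a quantum state of `B` for every letter. -/
structure CQState (X B : Type*) [Fintype X] [Fintype B] [DecidableEq B] where
  /-- The distribution of the classical letter. -/
  p : X → ℝ
  /-- The conditional states of `B`. -/
  state : X → Matrix B B ℂ
  p_nonneg : ∀ x, 0 ≤ p x
  p_sum : ∑ x, p x = 1
  state_density : ∀ x, IsDensity (state x)

/-- The bipartite density matrix `∑ x, p x |x⟩⟨x| ⊗ ρ x`. -/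
def CQState.toMatrix (S : CQState X B) : Matrix (X × B) (X × B) ℂ :=
  ∑ x, (S.p x : ℂ) • (Matrix.single x x (1 : ℂ) ⊗ₖ S.state x)

/-- The probability `p x₁ ⋯ p xₙ` of a source sequence. -/
def CQState.seqProb (S : CQState X B) {n : ℕ} (x : Fin n → X) : ℝ :=
  ∏ k, S.p (x k)

/-- The state `ρ x₁ ⊗ ⋯ ⊗ ρ xₙ` of `n` copies of `B`, in the product basis. -/
def CQState.seqState (S : CQState X B) {n : ℕ} (x : Fin n → X) :
    Matrix (Fin n → B) (Fin n → B) ℂ :=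
  Matrix.of fun i j => ∏ k, S.state (x k) (i k) (j k)

/-- A code of blocklength `n` with `M` messages: a possibly random encoder, mapping the sequence
`x` to the message `w` with probability `enc x w` (deterministic encoders are the `0`/`1`-valued
ones), and one POVM with outcomes in `X ^ n` on `n` copies of `B` for every message. -/
structure Code (X B : Type*) [Fintype X] [DecidableEq X] [Fintype B] [DecidableEq B]
    (n M : ℕ) where
  /-- The transition probabilities of the encoder. -/
  enc : (Fin n → X) → Fin M → ℝ
  /-- The POVM elements of the decoder. -/
  dec : Fin M → (Fin n → X) → Matrix (Fin n → B) (Fin n → B) ℂ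
  enc_nonneg : ∀ x w, 0 ≤ enc x w
  enc_sum : ∀ x, ∑ w, enc x w = 1
  dec_pos : ∀ w x, (dec w x).PosSemidef
  dec_sum : ∀ w, ∑ x, dec w x = 1

/-- The error probability of a code. -/
def errorProb (S : CQState X B) {n M : ℕ} (C : Code X B n M) : ℝ :=
  1 - ∑ x : Fin n → X, ∑ w : Fin M,
    C.enc x w * S.seqProb x * (C.dec w x * S.seqState x).trace.re

/-- The optimal error probability at blocklength `n` and rate `R`: the infimum over all codes whose
number `M` of messages is at most `2 ^ (n R)`. -/
def optError (S : CQState X B) (n : ℕ) (R : ℝ) : ℝ :=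
  sInf {e : ℝ | ∃ M : ℕ, (M : ℝ) ≤ (2 : ℝ) ^ ((n : ℝ) * R) ∧
    ∃ C : Code X B n M, e = errorProb S C}

/-- The finite blocklength strong converse exponent, logarithm to base `2`. -/
def scExponent (S : CQState X B) (n : ℕ) (R : ℝ) : ℝ :=
  -(1 / (n : ℝ)) * Real.logb 2 (1 - optError S n R)

/-- The supremum over `α > 1` of `(1-α)/α * (R - H_α)`, with the sandwiched Rényi conditional
entropy `H_α` of the classical letter given `B`. -/
def scBound (S : CQState X B) (R : ℝ) : EReal :=
  ⨆ α : {α : ℝ // 1 < α}, (((1 - (α : ℝ)) / (α : ℝ) : ℝ) : EReal) *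
    ((R : EReal) - sandwichedCondEntropy (α : ℝ) S.toMatrix)

end CQSW

end

/-! Converse. Fix a state `σ` whose support covers every `p x • ρ x`, and `α > 1`. A code yields
tests `T_x = ∑ w, P(w|x) Π_x^w` with `0 ≤ T_x ≤ 1`, and its success probability is `∑ x, Tr[T_x p(x)
ρ^x]`. Data processing for a single test (`trace_test_le`) bounds each term by `Q_x ^ (1/α) * Tr[T_x
σ^n] ^ ((α-1)/α)`. Hölder over the sequences separates `∑ x, Q_x` from `∑ x, Tr[T_x σ^n]`. The
latter is at most the number of messages; the former is the `n`-th power of a one-letter quantity,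
as `Q` is multiplicative (`successProb_le`). Taking `-(1/n) log` and optimizing over `σ` and `α`
gives the bound for every `n`, without asymptotics.

Positivity. Take `σ = ρ_B`. By `sandwichedQ_le`, `Q` is at most `Tr ρ^α + Tr ρ_B^(2-α) - 1`, which
equals `1` at `α = 1` and has derivative `-ln 2 * H(X|B)` there. With `log q ≤ q - 1`, for some `α >
1` the Rényi entropy exceeds `R` (`exists_lt_neg_sandwiched`), so that term of the supremum is
positive.

The matrix inequalities all come from one device: expand traces in an eigenbasis of one matrix and
apply scalar Jensen or Hölder to quadratic forms. -/

noncomputable section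

namespace CQSW

open scoped Kronecker ComplexOrder
open Matrix

/-! ### Spectral calculus and trace inequalities -/

section Spectral

variable {A : Type*} [Fintype A] [DecidableEq A]

/-- The real part of the quadratic form `⟨v, M v⟩`. -/
def quadForm (M : Matrix A A ℂ) (v : A → ℂ) : ℝ := (star v ⬝ᵥ M *ᵥ v).re

/-- `U` diagonalizes `M` with real eigenvalues `d`. -/
structure Diagonalizes (U : Matrix A A ℂ) (d : A → ℝ) (M : Matrix A A ℂ) : Prop where
  star_mul : Uᴴ * U = 1
  mul_star : U * Uᴴ = 1
  eq : M = U * diagonal (fun i => (d i : ℂ)) * Uᴴ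

lemma Diagonalizes.isHermitian {U : Matrix A A ℂ} {d : A → ℝ} {M : Matrix A A ℂ}
    (h : Diagonalizes U d M) : M.IsHermitian := by
  rw [h.eq, Matrix.IsHermitian, conjTranspose_mul, conjTranspose_mul, conjTranspose_conjTranspose,
    diagonal_conjTranspose, ← mul_assoc]
  congr 3
  ext i
  simp

lemma isHermitian_cfc_eq {M : Matrix A A ℂ} (hM : M.IsHermitian) (f : ℝ → ℝ) :
    cfc f M = (hM.eigenvectorUnitary : Matrix A A ℂ) *
      diagonal (fun i => (f (hM.eigenvalues i) : ℂ)) * (hM.eigenvectorUnitary : Matrix A A ℂ)ᴴ := by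
  rw [hM.cfc_eq, Matrix.IsHermitian.cfc, Unitary.conjStarAlgAut_apply]
  rfl

lemma diagonalizes_eigenvectorUnitary {M : Matrix A A ℂ} (hM : M.IsHermitian) :
    Diagonalizes (hM.eigenvectorUnitary : Matrix A A ℂ) hM.eigenvalues M where
  star_mul := by rw [← star_eq_conjTranspose]; exact Unitary.coe_star_mul_self _
  mul_star := by rw [← star_eq_conjTranspose]; exact Unitary.coe_mul_star_self _
  eq := by
    conv_lhs => rw [hM.spectral_theorem, Unitary.conjStarAlgAut_apply]
    rfl

/-- The functional calculus of a Hermitian matrix does not depend on the diagonalization. -/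
lemma Diagonalizes.cfc {U : Matrix A A ℂ} {d : A → ℝ} {M : Matrix A A ℂ}
    (h : Diagonalizes U d M) (f : ℝ → ℝ) : Diagonalizes U (fun i => f (d i)) (cfc f M) := by
  refine ⟨h.star_mul, h.mul_star, ?_⟩
  have hV := diagonalizes_eigenvectorUnitary h.isHermitian
  rw [isHermitian_cfc_eq h.isHermitian]
  set V : Matrix A A ℂ := (h.isHermitian.eigenvectorUnitary : Matrix A A ℂ)
  set c := h.isHermitian.eigenvalues
  have hW : diagonal (fun i => (c i : ℂ)) * (Vᴴ * U) = (Vᴴ * U) * diagonal fun i => (d i : ℂ) := by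
    have h1 : Vᴴ * M * U = diagonal (fun i => (c i : ℂ)) * (Vᴴ * U) := by
      rw [hV.eq]
      simp only [← mul_assoc, hV.star_mul, one_mul]
    have h2 : Vᴴ * M * U = (Vᴴ * U) * diagonal fun i => (d i : ℂ) := by
      rw [h.eq]
      simp only [mul_assoc, h.star_mul, mul_one]
    rw [← h1, h2]
  -- By `hW`, the `(i, j)` entry of `Vᴴ * U` vanishes unless `c i = d j`, so the intertwining
  -- survives applying `f` to both diagonals.
  have hF : diagonal (fun i => (f (c i) : ℂ)) * (Vᴴ * U) =
      (Vᴴ * U) * diagonal fun i => (f (d i) : ℂ) := by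
    ext i j
    have := congrFun (congrFun hW i) j
    rw [diagonal_mul, mul_diagonal] at this ⊢
    by_cases h0 : (Vᴴ * U) i j = 0
    · simp [h0]
    · rw [mul_comm] at this
      have := mul_left_cancel₀ h0 this
      rw [Complex.ofReal_inj.1 this, mul_comm]
  calc _ = V * (diagonal (fun i => (f (c i) : ℂ)) * (Vᴴ * U)) * Uᴴ := by
        simp only [mul_assoc, h.mul_star, mul_one]
    _ = _ := by
        rw [hF]
        simp only [← mul_assoc, hV.mul_star, one_mul]

omit [DecidableEq A] in
lemma quadForm_conj (M K : Matrix A A ℂ) (v : A → ℂ) :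
    quadForm (Kᴴ * M * K) v = quadForm M (K *ᵥ v) := by
  simp only [quadForm, star_mulVec, ← mulVec_mulVec, dotProduct_mulVec, vecMul_vecMul]

omit [DecidableEq A] in
lemma quadForm_nonneg {M : Matrix A A ℂ} (hM : M.PosSemidef) (v : A → ℂ) : 0 ≤ quadForm M v :=
  (Complex.le_def.1 (hM.dotProduct_mulVec_nonneg v)).1

omit [DecidableEq A] in
lemma quadForm_sub (M N : Matrix A A ℂ) (v : A → ℂ) :
    quadForm (M - N) v = quadForm M v - quadForm N v := by
  simp [quadForm, sub_mulVec, dotProduct_sub]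

omit [DecidableEq A] in
lemma quadForm_col (M U : Matrix A A ℂ) (i : A) :
    quadForm M (fun k => U k i) = ((Uᴴ * M * U) i i).re := by
  rw [quadForm, mul_assoc]
  simp only [mul_apply, dotProduct, mulVec, conjTranspose_apply, Pi.star_apply]

lemma Diagonalizes.quadForm_col {U : Matrix A A ℂ} {d : A → ℝ} {M : Matrix A A ℂ}
    (h : Diagonalizes U d M) (i : A) : quadForm M (fun k => U k i) = d i := by
  rw [CQSW.quadForm_col, h.eq]
  simp only [mul_assoc, h.star_mul, mul_one]
  simp only [← mul_assoc, h.star_mul, one_mul, diagonal_apply_eq, Complex.ofReal_re]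

lemma Diagonalizes.quadForm_eq {U : Matrix A A ℂ} {d : A → ℝ} {M : Matrix A A ℂ}
    (h : Diagonalizes U d M) (v : A → ℂ) :
    quadForm M v = ∑ j, d j * Complex.normSq ((Uᴴ *ᵥ v) j) := by
  have : M = (Uᴴ)ᴴ * diagonal (fun i => (d i : ℂ)) * Uᴴ := by
    rw [conjTranspose_conjTranspose]; exact h.eq
  rw [this, quadForm_conj, quadForm, dotProduct, Complex.re_sum]
  refine Finset.sum_congr rfl fun j _ => ?_
  rw [mulVec_diagonal, Pi.star_apply, mul_left_comm, Complex.star_def,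
    ← Complex.normSq_eq_conj_mul_self, ← Complex.ofReal_mul, Complex.ofReal_re]

/-- Every Hermitian matrix has an orthonormal basis of eigenvectors. -/
lemma exists_eigenframe {N : Matrix A A ℂ} (hN : N.IsHermitian) :
    ∃ e : A → A → ℂ, (∀ i, quadForm 1 (e i) = 1) ∧
      (∀ M : Matrix A A ℂ, M.trace.re = ∑ i, quadForm M (e i)) ∧
      ∀ (M : Matrix A A ℂ) (f : ℝ → ℝ),
        (M * cfc f N).trace.re = ∑ i, f (quadForm N (e i)) * quadForm M (e i) := by
  have h := diagonalizes_eigenvectorUnitary hN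
  set U : Matrix A A ℂ := (hN.eigenvectorUnitary : Matrix A A ℂ)
  refine ⟨fun i k => U k i, fun i => ?_, fun M => ?_, fun M f => ?_⟩
  · rw [quadForm_col, mul_one, h.star_mul, one_apply_eq, Complex.one_re]
  · simp_rw [quadForm_col]
    have : M.trace = (Uᴴ * M * U).trace := by
      rw [mul_assoc, trace_mul_comm, mul_assoc, h.mul_star, mul_one]
    rw [this, trace, Complex.re_sum]
    rfl
  · simp_rw [h.quadForm_col, quadForm_col]
    rw [(h.cfc f).eq, ← mul_assoc, trace_mul_comm, ← mul_assoc, ← mul_assoc, trace,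
      Complex.re_sum]
    refine Finset.sum_congr rfl fun i _ => ?_
    rw [diag_apply, mul_diagonal, mul_comm, Complex.re_ofReal_mul]

/-- The scalar function defining `matPow`. -/
def suppPow (s a : ℝ) : ℝ := if a = 0 then 0 else a ^ s

lemma suppPow_nonneg (s : ℝ) {a : ℝ} (ha : 0 ≤ a) : 0 ≤ suppPow s a := by
  unfold suppPow; split_ifs <;> positivity

lemma suppPow_mul (s t : ℝ) {a : ℝ} (ha : 0 ≤ a) :
    suppPow s a * suppPow t a = suppPow (s + t) a := by
  unfold suppPow
  split_ifs with h
  · simp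
  · rw [Real.rpow_add (ha.lt_of_ne' h)]

lemma suppPow_one (a : ℝ) : suppPow 1 a = a := by
  unfold suppPow; split_ifs with h <;> simp [h]

lemma suppPow_of_ne {s : ℝ} (hs : s ≠ 0) (a : ℝ) : suppPow s a = a ^ s := by
  unfold suppPow; split_ifs with h
  · rw [h, Real.zero_rpow hs]
  · rfl

lemma matPow_eq_cfc (M : Matrix A A ℂ) (s : ℝ) : matPow M s = cfc (suppPow s) M := rfl

lemma Diagonalizes.nonneg {U : Matrix A A ℂ} {d : A → ℝ} {M : Matrix A A ℂ}
    (h : Diagonalizes U d M) (hM : M.PosSemidef) (i : A) : 0 ≤ d i := by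
  rw [← h.quadForm_col i]; exact quadForm_nonneg hM _

lemma Diagonalizes.posSemidef {U : Matrix A A ℂ} {d : A → ℝ} {M : Matrix A A ℂ}
    (h : Diagonalizes U d M) (hd : ∀ i, 0 ≤ d i) : M.PosSemidef := by
  rw [h.eq]
  refine PosSemidef.mul_mul_conjTranspose_same (PosSemidef.diagonal fun i => ?_) _
  simpa using hd i

lemma Diagonalizes.matPow {U : Matrix A A ℂ} {d : A → ℝ} {M : Matrix A A ℂ}
    (h : Diagonalizes U d M) (s : ℝ) : Diagonalizes U (fun i => suppPow s (d i)) (matPow M s) :=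
  h.cfc _

lemma exists_diagonalizes {M : Matrix A A ℂ} (hM : M.PosSemidef) :
    ∃ (U : Matrix A A ℂ) (d : A → ℝ), Diagonalizes U d M ∧ ∀ i, 0 ≤ d i :=
  ⟨_, _, diagonalizes_eigenvectorUnitary hM.1, (diagonalizes_eigenvectorUnitary hM.1).nonneg hM⟩

lemma matPow_posSemidef {M : Matrix A A ℂ} (hM : M.PosSemidef) (s : ℝ) :
    (matPow M s).PosSemidef := by
  obtain ⟨U, d, h, hd⟩ := exists_diagonalizes hM
  exact (h.matPow s).posSemidef fun i => suppPow_nonneg s (hd i)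

/-- Exponents add without sign conditions because the kernel is always sent to zero; in particular
`matPow M 0` is the support projection, not the identity. -/
lemma matPow_mul_matPow {M : Matrix A A ℂ} (hM : M.PosSemidef) (s t : ℝ) :
    matPow M s * matPow M t = matPow M (s + t) := by
  obtain ⟨U, d, h, hd⟩ := exists_diagonalizes hM
  rw [(h.matPow s).eq, (h.matPow t).eq, (h.matPow (s + t)).eq]
  have : ∀ D E : Matrix A A ℂ, U * D * Uᴴ * (U * E * Uᴴ) = U * (D * E) * Uᴴ := fun D E => by
    calc _ = U * D * (Uᴴ * U) * E * Uᴴ := by simp only [mul_assoc]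
      _ = _ := by rw [h.star_mul, mul_one]; simp only [mul_assoc]
  rw [this, diagonal_mul_diagonal]
  congr 3
  ext i
  rw [← Complex.ofReal_mul, suppPow_mul s t (hd i)]

lemma matPow_one {M : Matrix A A ℂ} (hM : M.PosSemidef) : matPow M 1 = M := by
  obtain ⟨U, d, h, hd⟩ := exists_diagonalizes hM
  rw [(h.matPow 1).eq]
  simp_rw [suppPow_one]
  exact h.eq.symm

lemma matPow_mul_matPow_eq {M : Matrix A A ℂ} (hM : M.PosSemidef) {s t u : ℝ} (h : s + t = u) :
    matPow M s * matPow M t = matPow M u := h ▸ matPow_mul_matPow hM s t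

lemma half_mul_half {M : Matrix A A ℂ} (hM : M.PosSemidef) :
    matPow M (1 / 2) * matPow M (1 / 2) = M := by
  rw [matPow_mul_matPow hM, add_halves, matPow_one hM]

lemma quadForm_matPow_zero_le {M : Matrix A A ℂ} (hM : M.PosSemidef) (v : A → ℂ) :
    quadForm (matPow M 0) v ≤ quadForm 1 v := by
  obtain ⟨U, d, h, hd⟩ := exists_diagonalizes hM
  have h1 : Diagonalizes U (fun _ => 1) (1 : Matrix A A ℂ) :=
    ⟨h.star_mul, h.mul_star, by simp [h.mul_star]⟩
  rw [(h.matPow 0).quadForm_eq, h1.quadForm_eq]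
  refine Finset.sum_le_sum fun j _ => mul_le_mul_of_nonneg_right ?_ (Complex.normSq_nonneg _)
  unfold suppPow; split_ifs <;> simp

/-- If all eigenvalues of `M` are at most `1`, then negative powers dominate the support
projection. -/
lemma quadForm_matPow_zero_le_neg {M : Matrix A A ℂ} (hM : M.PosSemidef)
    (hM1 : ∀ v, quadForm M v ≤ quadForm 1 v) {s : ℝ} (hs : s ≤ 0) (v : A → ℂ) :
    quadForm (matPow M 0) v ≤ quadForm (matPow M s) v := by
  obtain ⟨U, d, h, hd⟩ := exists_diagonalizes hM
  have h1 : Diagonalizes U (fun _ => 1) (1 : Matrix A A ℂ) :=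
    ⟨h.star_mul, h.mul_star, by simp [h.mul_star]⟩
  rw [(h.matPow 0).quadForm_eq, (h.matPow s).quadForm_eq]
  refine Finset.sum_le_sum fun j _ => mul_le_mul_of_nonneg_right ?_ (Complex.normSq_nonneg _)
  have hj : d j ≤ 1 := by
    rw [← h.quadForm_col j, ← h1.quadForm_col j]; exact hM1 _
  unfold suppPow; split_ifs with h0
  · exact le_rfl
  · rw [Real.rpow_zero]
    exact Real.one_le_rpow_of_pos_of_le_one_of_nonpos ((hd j).lt_of_ne' h0) hj hs

/-- Jensen's inequality for the spectral measure of `M` at `v`. -/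
lemma quadForm_matPow_rpow_le {M : Matrix A A ℂ} (hM : M.PosSemidef) (s : ℝ) {r : ℝ} (hr : 1 ≤ r)
    (v : A → ℂ) :
    quadForm (matPow M s) v ^ r ≤
      quadForm 1 v ^ (r - 1) * quadForm (matPow M (s * r)) v := by
  obtain ⟨U, d, h, hd⟩ := exists_diagonalizes hM
  have hr0 : 0 < r := by linarith
  -- The spectral weights of `v`, cut down to the support of `M`; their total mass is therefore only
  -- bounded by `quadForm 1 v`.
  set w : A → ℝ := fun j => suppPow 0 (d j) * Complex.normSq ((Uᴴ *ᵥ v) j)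
  have hw : ∀ j, 0 ≤ w j := fun j => mul_nonneg (suppPow_nonneg _ (hd j)) (Complex.normSq_nonneg _)
  have h0 : ∑ j, w j ≤ quadForm 1 v := by
    rw [← (h.matPow 0).quadForm_eq]; exact quadForm_matPow_zero_le hM v
  have hs : quadForm (matPow M s) v = ∑ j, w j * suppPow s (d j) := by
    rw [(h.matPow s).quadForm_eq]
    refine Finset.sum_congr rfl fun j _ => ?_
    rw [mul_right_comm, suppPow_mul 0 s (hd j), zero_add]
  have hsr : quadForm (matPow M (s * r)) v = ∑ j, w j * suppPow s (d j) ^ r := by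
    rw [(h.matPow (s * r)).quadForm_eq]
    refine Finset.sum_congr rfl fun j _ => ?_
    rw [mul_right_comm]
    congr 1
    unfold suppPow
    split_ifs with hj
    · simp
    · rw [Real.rpow_zero, one_mul, Real.rpow_mul (hd j)]
  have hsn : 0 ≤ ∑ j, w j * suppPow s (d j) ^ r := Finset.sum_nonneg fun j _ =>
    mul_nonneg (hw j) (Real.rpow_nonneg (suppPow_nonneg _ (hd j)) _)
  have key := Real.inner_le_weight_mul_Lp_of_nonneg Finset.univ hr w (fun j => suppPow s (d j)) hw
    (fun j => suppPow_nonneg s (hd j))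
  have hw0 : 0 ≤ ∑ j, w j := Finset.sum_nonneg fun j _ => hw j
  rw [hs, hsr]
  calc _ ≤ ((∑ j, w j) ^ (1 - r⁻¹) * (∑ j, w j * suppPow s (d j) ^ r) ^ r⁻¹) ^ r :=
        Real.rpow_le_rpow (Finset.sum_nonneg fun j _ => mul_nonneg (hw j)
          (suppPow_nonneg s (hd j))) key hr0.le
    _ = (∑ j, w j) ^ (r - 1) * ∑ j, w j * suppPow s (d j) ^ r := by
        rw [Real.mul_rpow (by positivity) (by positivity), ← Real.rpow_mul hw0, ← Real.rpow_mul hsn,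
          inv_mul_cancel₀ hr0.ne', Real.rpow_one, sub_mul, inv_mul_cancel₀ hr0.ne', one_mul]
    _ ≤ _ := mul_le_mul_of_nonneg_right (Real.rpow_le_rpow hw0 h0 (by linarith)) hsn

lemma trace_cfc_re {N : Matrix A A ℂ} (hN : N.IsHermitian) (f : ℝ → ℝ) :
    (cfc f N).trace.re = ∑ i, f (hN.eigenvalues i) := by
  rw [((diagonalizes_eigenvectorUnitary hN).cfc f).eq, trace_mul_comm, ← mul_assoc,
    (diagonalizes_eigenvectorUnitary hN).star_mul, one_mul, trace_diagonal, Complex.re_sum]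
  rfl

/-- `Kᴴ * K` and `K * Kᴴ` share their characteristic polynomial, hence their eigenvalues with
multiplicity. -/
lemma trace_matPow_conjTranspose_mul_comm (K : Matrix A A ℂ) (s : ℝ) :
    (matPow (Kᴴ * K) s).trace.re = (matPow (K * Kᴴ) s).trace.re := by
  rw [matPow, matPow, trace_cfc_re (isHermitian_conjTranspose_mul_self K),
    trace_cfc_re (isHermitian_mul_conjTranspose_self K),
    (IsHermitian.eigenvalues_eq_eigenvalues_iff _ _).2 (charpoly_mul_comm _ _)]

omit [DecidableEq A] in
lemma trace_re_nonneg {M : Matrix A A ℂ} (hM : M.PosSemidef) : 0 ≤ M.trace.re :=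
  (Complex.le_def.1 hM.trace_nonneg).1

/-- Hölder's inequality for the trace of a product of positive semidefinite matrices. -/
lemma trace_mul_le_holder {M N : Matrix A A ℂ} (hM : M.PosSemidef) (hN : N.PosSemidef) {p q : ℝ}
    (hpq : p.HolderConjugate q) :
    (M * N).trace.re ≤ (matPow M p).trace.re ^ (1 / p) * (matPow N q).trace.re ^ (1 / q) := by
  -- In the eigenbasis of `N` the trace of `N ^ q` is exact, while Jensen bounds the diagonal of `M`
  -- by that of `M ^ p`; scalar Hölder does the rest.
  obtain ⟨e, he1, htr, he⟩ := exists_eigenframe hN.1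
  have h1 : (M * N).trace.re = ∑ i, quadForm M (e i) * quadForm N (e i) := by
    conv_lhs => rw [← matPow_one hN, matPow_eq_cfc, he]
    simp_rw [suppPow_one, mul_comm]
  have hq : (matPow N q).trace.re = ∑ i, quadForm N (e i) ^ q := by
    rw [← one_mul (matPow N q), matPow_eq_cfc, he]
    simp_rw [he1, suppPow_of_ne hpq.symm.ne_zero, mul_one]
  have hp : ∑ i, quadForm M (e i) ^ p ≤ (matPow M p).trace.re := by
    rw [htr]
    refine Finset.sum_le_sum fun i _ => ?_
    have := quadForm_matPow_rpow_le hM 1 hpq.lt.le (e i)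
    rwa [he1, matPow_one hM, Real.one_rpow, one_mul, one_mul] at this
  rw [h1, hq]
  refine (Real.inner_le_Lp_mul_Lq_of_nonneg Finset.univ hpq (fun i _ => quadForm_nonneg hM _)
    fun i _ => quadForm_nonneg hN _).trans ?_
  refine mul_le_mul_of_nonneg_right (Real.rpow_le_rpow ?_ hp ?_) ?_
  · exact Finset.sum_nonneg fun i _ => Real.rpow_nonneg (quadForm_nonneg hM _) _
  · exact one_div_nonneg.2 hpq.nonneg
  · exact Real.rpow_nonneg
      (Finset.sum_nonneg fun i _ => Real.rpow_nonneg (quadForm_nonneg hN _) _) _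

lemma quadForm_one_mulVec (t : Matrix A A ℂ) (v : A → ℂ) :
    quadForm 1 (t *ᵥ v) = quadForm (tᴴ * t) v := by
  rw [← quadForm_conj, mul_one]

/-- Jensen's trace inequality for the compression by a contraction. -/
lemma trace_matPow_compress_le {σ T : Matrix A A ℂ} (hσ : σ.PosSemidef) (hT : T.PosSemidef)
    (hT1 : ∀ v, quadForm T v ≤ quadForm 1 v) {r : ℝ} (hr : 1 ≤ r) :
    (matPow (matPow T (1 / 2) * matPow σ (1 / r) * matPow T (1 / 2)) r).trace.re ≤
      (T * σ).trace.re := by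
  have hr0 : r ≠ 0 := by linarith
  set t := matPow T (1 / 2)
  have ht : tᴴ = t := (matPow_posSemidef hT _).1
  have hN : (t * matPow σ (1 / r) * t).PosSemidef := by
    have := (matPow_posSemidef hσ (1 / r)).conjTranspose_mul_mul_same t
    rwa [ht] at this
  have hq : ∀ M v, quadForm (t * M * t) v = quadForm M (t *ᵥ v) := fun M v => by
    rw [← quadForm_conj, ht]
  obtain ⟨e, he1, htr, he⟩ := exists_eigenframe hN.1
  have h1 : (T * σ).trace.re = ∑ i, quadForm (t * σ * t) (e i) := by
    rw [← htr, mul_assoc, trace_mul_comm t, mul_assoc, half_mul_half hT, trace_mul_comm]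
  rw [← one_mul (matPow _ r), matPow_eq_cfc, he, h1]
  refine Finset.sum_le_sum fun i _ => ?_
  rw [suppPow_of_ne hr0, he1, mul_one, hq, hq]
  -- The Jensen prefactor is a power of `‖t e_i‖²`, at most `1` because `t * t = T` is a
  -- contraction.
  have h := quadForm_matPow_rpow_le hσ (1 / r) hr (t *ᵥ e i)
  rw [one_div_mul_cancel hr0, matPow_one hσ] at h
  refine h.trans (mul_le_of_le_one_left (quadForm_nonneg hσ _) ?_)
  have h2 : quadForm 1 (t *ᵥ e i) ≤ 1 := by
    rw [quadForm_one_mulVec, ht, half_mul_half hT, ← he1 i]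
    exact hT1 _
  refine Real.rpow_le_one (quadForm_nonneg PosSemidef.one _) h2 (by linarith)

/-- The root factors as `ρ * ρ ^ (-1/2)`, so whatever fixes `ρ` from the left fixes it too. -/
lemma half_of_supp {ρ P : Matrix A A ℂ} (hρ : ρ.PosSemidef) (h : P * ρ = ρ) :
    P * matPow ρ (1 / 2) = matPow ρ (1 / 2) := by
  have : matPow ρ (1 / 2) = ρ * matPow ρ (-(1 / 2)) := by
    rw [← matPow_mul_matPow_eq hρ (s := 1) (t := -(1 / 2)) (by norm_num), matPow_one hρ]
  rw [this, ← mul_assoc, h]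

lemma sandwichedQ_inner_posSemidef {ρ σ : Matrix A A ℂ} (hρ : ρ.PosSemidef) (hσ : σ.PosSemidef)
    (s : ℝ) : (matPow ρ (1 / 2) * matPow σ s * matPow ρ (1 / 2)).PosSemidef := by
  have := (matPow_posSemidef hσ s).conjTranspose_mul_mul_same (matPow ρ (1 / 2))
  rwa [(matPow_posSemidef hρ (1 / 2)).1] at this

lemma sandwichedQ_nonneg {ρ σ : Matrix A A ℂ} (hρ : ρ.PosSemidef) (hσ : σ.PosSemidef) (α : ℝ) :
    0 ≤ sandwichedQ α ρ σ :=
  trace_re_nonneg (matPow_posSemidef (sandwichedQ_inner_posSemidef hρ hσ _) _)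

/-- The data processing inequality of the sandwiched Rényi divergence for a binary test. -/
lemma trace_test_le {ρ σ T : Matrix A A ℂ} (hρ : ρ.PosSemidef) (hσ : σ.PosSemidef)
    (hT : T.PosSemidef) (hT1 : ∀ v, quadForm T v ≤ quadForm 1 v)
    (hsupp : matPow σ 0 * ρ = ρ) {α : ℝ} (hα : 1 < α) :
    (T * ρ).trace.re ≤
      sandwichedQ α ρ σ ^ (1 / α) * (T * σ).trace.re ^ ((α - 1) / α) := by
  have hpq : α.HolderConjugate (α / (α - 1)) := Real.HolderConjugate.conjExponent hα
  obtain ⟨γ, hγ⟩ : ∃ γ, (α - 1) / α = γ := ⟨_, rfl⟩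
  obtain ⟨β, hβ⟩ : ∃ β, α / (α - 1) = β := ⟨_, rfl⟩
  rw [hβ] at hpq
  rw [hγ]
  have hγ' : 1 / β = γ := by rw [← hβ, one_div_div, hγ]
  obtain ⟨r, hr⟩ : ∃ r, matPow ρ (1 / 2) = r := ⟨_, rfl⟩
  obtain ⟨t, ht⟩ : ∃ t, matPow T (1 / 2) = t := ⟨_, rfl⟩
  have hrr : r * r = ρ := by rw [← hr, half_mul_half hρ]
  have htt : t * t = T := by rw [← ht, half_mul_half hT]
  have hr' : rᴴ = r := by rw [← hr]; exact (matPow_posSemidef hρ _).1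
  have ht' : tᴴ = t := by rw [← ht]; exact (matPow_posSemidef hT _).1
  have hs' : ∀ s, (matPow σ s)ᴴ = matPow σ s := fun s => (matPow_posSemidef hσ _).1
  -- Inserting `σ ^ (γ/2) σ ^ (-γ/2)` between `T` and `ρ` makes `Kᴴ * K` the sandwiched operator and
  -- `Lᴴ * L` the compression of `σ ^ (1/β)` by `T`.
  set K := matPow σ (-γ / 2) * r with hK
  set L := matPow σ (γ / 2) * t with hL
  have hKK : Kᴴ * K = r * matPow σ ((1 - α) / α) * r := by
    rw [hK, conjTranspose_mul, hr', hs', mul_assoc, ← mul_assoc _ _ r,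
      matPow_mul_matPow_eq hσ (u := (1 - α) / α) (by rw [← hγ]; ring), mul_assoc]
  have hLL : Lᴴ * L = t * matPow σ (1 / β) * t := by
    rw [hL, conjTranspose_mul, ht', hs', mul_assoc, ← mul_assoc _ _ t,
      matPow_mul_matPow_eq hσ (u := 1 / β) (by rw [hγ']; ring), mul_assoc]
  have hsK : matPow σ (γ / 2) * K = r := by
    rw [hK, ← mul_assoc, matPow_mul_matPow_eq hσ (u := 0) (by ring)]
    rw [← hr, half_of_supp hρ hsupp]
  have htr : (T * ρ).trace = (K * Kᴴ * (L * Lᴴ)).trace := by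
    have h1 : ρ = matPow σ (γ / 2) * K * (matPow σ (γ / 2) * K)ᴴ := by
      rw [hsK, hr', hrr]
    have h2 : L * Lᴴ = matPow σ (γ / 2) * T * matPow σ (γ / 2) := by
      rw [hL, conjTranspose_mul, ht', hs', mul_assoc, ← mul_assoc t, htt, mul_assoc]
    conv_lhs => rw [h1]
    rw [h2, conjTranspose_mul, hs', trace_mul_comm]
    have : matPow σ (γ / 2) * K * (Kᴴ * matPow σ (γ / 2)) * T
        = matPow σ (γ / 2) * (K * Kᴴ * (matPow σ (γ / 2) * T)) := by simp only [mul_assoc]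
    rw [this, trace_mul_comm]
    simp only [mul_assoc]
  have hQ : sandwichedQ α ρ σ = (matPow (K * Kᴴ) α).trace.re := by
    rw [← trace_matPow_conjTranspose_mul_comm, hKK, sandwichedQ, hr]
  rw [htr, hQ]
  refine (trace_mul_le_holder (posSemidef_self_mul_conjTranspose K)
    (posSemidef_self_mul_conjTranspose L) hpq).trans ?_
  have hcomp := trace_matPow_compress_le hσ hT hT1 hpq.symm.lt.le
  rw [ht, hγ'] at hcomp
  rw [← trace_matPow_conjTranspose_mul_comm L, hLL, hγ']
  refine mul_le_mul_of_nonneg_left (Real.rpow_le_rpow ?_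
    hcomp (by rw [← hγ]; exact div_nonneg (by linarith) (by linarith)))
    (Real.rpow_nonneg (trace_re_nonneg
      (matPow_posSemidef (posSemidef_self_mul_conjTranspose K) _)) _)
  rw [← hγ', ← hLL]
  exact trace_re_nonneg (matPow_posSemidef (posSemidef_conjTranspose_mul_self L) _)

/-- An upper bound on the sandwiched quantity which is tight to first order at `α = 1`. -/
lemma sandwichedQ_le {ρ σ : Matrix A A ℂ} (hρ : IsDensity ρ) (hσ : σ.PosSemidef)
    (hσ1 : ∀ v, quadForm σ v ≤ quadForm 1 v) (hsupp : matPow σ 0 * ρ = ρ) {α : ℝ} (hα : 1 < α) :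
    sandwichedQ α ρ σ ≤ (matPow ρ α).trace.re + (ρ * matPow σ (1 - α)).trace.re - 1 := by
  obtain ⟨hρ, hρt⟩ := hρ
  have hα0 : α ≠ 0 := by linarith
  set r := matPow ρ (1 / 2) with hr
  have hr' : rᴴ = r := (matPow_posSemidef hρ _).1
  have hN := sandwichedQ_inner_posSemidef hρ hσ ((1 - α) / α)
  obtain ⟨e, he1, htr, he⟩ := exists_eigenframe hN.1
  have hq : ∀ M v, quadForm (r * M * r) v = quadForm M (r *ᵥ v) := fun M v => by
    rw [← quadForm_conj, hr']
  have h1 : ∀ v, quadForm 1 (r *ᵥ v) = quadForm ρ v := fun v => by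
    rw [quadForm_one_mulVec, hr', half_mul_half hρ]
  have hP : ∀ v, quadForm (matPow σ 0) (r *ᵥ v) = quadForm ρ v := fun v => by
    rw [← hq, mul_assoc, half_of_supp hρ hsupp, half_mul_half hρ]
  have hs : (ρ * matPow σ (1 - α)).trace.re = ∑ i, quadForm (matPow σ (1 - α)) (r *ᵥ e i) := by
    simp_rw [← hq]
    rw [← htr, mul_assoc, trace_mul_comm r, mul_assoc, half_mul_half hρ, trace_mul_comm]
  have hQ : sandwichedQ α ρ σ = ∑ i, quadForm (matPow σ ((1 - α) / α)) (r *ᵥ e i) ^ α := by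
    rw [sandwichedQ, ← one_mul (matPow _ α), matPow_eq_cfc _ α, he]
    simp_rw [suppPow_of_ne hα0, he1, mul_one]
    simp_rw [← hr, hq]
  have hone : ∑ i, quadForm ρ (e i) = 1 := by rw [← htr, hρt, Complex.one_re]
  have hle1 : ∀ i, quadForm ρ (e i) ≤ 1 := fun i => by
    rw [← hone]
    exact Finset.single_le_sum (f := fun i => quadForm ρ (e i))
      (fun j _ => quadForm_nonneg hρ _) (Finset.mem_univ i)
  have hα' : (matPow ρ α).trace.re + (ρ * matPow σ (1 - α)).trace.re - 1 =
      ∑ i, (quadForm (matPow ρ α) (e i) +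
        (quadForm (matPow σ (1 - α)) (r *ᵥ e i) - quadForm ρ (e i))) := by
    rw [Finset.sum_add_distrib, Finset.sum_sub_distrib, hone, ← hs, ← htr]; ring
  rw [hQ, hα']
  refine Finset.sum_le_sum fun i _ => ?_
  have a1 := quadForm_matPow_rpow_le hσ ((1 - α) / α) hα.le (r *ᵥ e i)
  rw [h1, div_mul_cancel₀ _ hα0] at a1
  have a2 := quadForm_matPow_rpow_le hρ 1 hα.le (e i)
  rw [he1, Real.one_rpow, one_mul, one_mul, matPow_one hρ] at a2
  have a3 := quadForm_matPow_zero_le_neg hσ hσ1 (s := 1 - α) (by linarith) (r *ᵥ e i)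
  rw [hP] at a3
  have hnn := quadForm_nonneg hρ (e i)
  have a4 : quadForm ρ (e i) ^ (α - 1) ≤ 1 := Real.rpow_le_one hnn (hle1 i) (by linarith)
  have a5 : quadForm ρ (e i) ^ α = quadForm ρ (e i) ^ (α - 1) * quadForm ρ (e i) := by
    rw [← Real.rpow_add_one' hnn (by linarith), sub_add_cancel]
  have a6 : 0 ≤ quadForm ρ (e i) ^ (α - 1) := Real.rpow_nonneg hnn _
  -- With `u = ⟨e, ρ e⟩ ≤ 1` and `b` the form of `σ ^ (1-α)`, `b ≥ u`: expanding `(1 - u ^ (α-1)) (b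
  -- - u) ≥ 0` gives `u ^ (α-1) b ≤ u ^ α + b - u`.
  nlinarith [mul_nonneg (sub_nonneg.2 a4) (sub_nonneg.2 a3)]

end Spectral

/-! ### Positivity and supports -/

section QuadForm

variable {A : Type*} [Fintype A] [DecidableEq A]

omit [DecidableEq A] in
lemma quadForm_sum {ι : Type*} (s : Finset ι) (M : ι → Matrix A A ℂ) (v : A → ℂ) :
    quadForm (∑ i ∈ s, M i) v = ∑ i ∈ s, quadForm (M i) v := by
  simp [quadForm, sum_mulVec, dotProduct_sum]

omit [DecidableEq A] in
lemma quadForm_smul (c : ℝ) (M : Matrix A A ℂ) (v : A → ℂ) :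
    quadForm ((c : ℂ) • M) v = c * quadForm M v := by
  simp [quadForm, smul_mulVec, dotProduct_smul]

lemma trace_mul_re_nonneg {M N : Matrix A A ℂ} (hM : M.PosSemidef) (hN : N.PosSemidef) :
    0 ≤ (M * N).trace.re := by
  obtain ⟨e, -, -, he⟩ := exists_eigenframe hN.1
  rw [← matPow_one hN, matPow_eq_cfc, he]
  exact Finset.sum_nonneg fun i _ => mul_nonneg (suppPow_nonneg _ (quadForm_nonneg hN _))
    (quadForm_nonneg hM _)

omit [DecidableEq A] in
lemma ofReal_trace_re_of_posSemidef {M : Matrix A A ℂ} (hM : M.PosSemidef) :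
    ((M.trace.re : ℝ) : ℂ) = M.trace :=
  Complex.ext rfl (Complex.le_def.1 hM.trace_nonneg).2

/-- The range of `1 - matPow σ 0` lies in the kernel of `σ`, hence in that of `ρ`; take adjoints. -/
lemma supp_mul_of_suppLE {ρ σ : Matrix A A ℂ} (hρ : ρ.PosSemidef) (hσ : σ.PosSemidef)
    (h : SuppLE ρ σ) : matPow σ 0 * ρ = ρ := by
  have h1 : σ * (1 - matPow σ 0) = 0 := by
    rw [mul_sub, mul_one, sub_eq_zero]
    conv_rhs => enter [1]; rw [← matPow_one hσ]
    rw [matPow_mul_matPow_eq hσ (u := 1) (by norm_num), matPow_one hσ]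
  have h2 : ρ * (1 - matPow σ 0) = 0 := by
    refine Matrix.ext_of_mulVec_single fun j => ?_
    rw [zero_mulVec, ← mulVec_mulVec]
    have : (1 - matPow σ 0) *ᵥ Pi.single j 1 ∈ LinearMap.ker σ.mulVecLin := by
      rw [LinearMap.mem_ker, mulVecLin_apply, mulVec_mulVec, h1, zero_mulVec]
    exact LinearMap.mem_ker.1 (h this)
  have h3 := congrArg conjTranspose h2
  rw [conjTranspose_mul, conjTranspose_sub, conjTranspose_one, (matPow_posSemidef hσ 0).1, hρ.1,
    conjTranspose_zero, sub_mul, one_mul, sub_eq_zero] at h3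
  exact h3.symm

end QuadForm

/-! ### Classical-quantum states as block diagonal matrices -/

section Block

variable {X B : Type*} [Fintype X] [DecidableEq X] [Fintype B] [DecidableEq B]

/-- The block diagonal matrix with blocks `M x`, the block index being the first coordinate. -/
def blockMat (M : X → Matrix B B ℂ) : Matrix (X × B) (X × B) ℂ :=
  of fun i j => if i.1 = j.1 then M i.1 i.2 j.2 else 0

omit [Fintype X] [Fintype B] [DecidableEq B] in
lemma blockMat_apply (M : X → Matrix B B ℂ) (i j : X × B) :
    blockMat M i j = if i.1 = j.1 then M i.1 i.2 j.2 else 0 := rfl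

omit [DecidableEq B] in
lemma blockMat_mul (M N : X → Matrix B B ℂ) :
    blockMat M * blockMat N = blockMat fun x => M x * N x := by
  ext i j
  simp only [mul_apply, blockMat_apply, Fintype.sum_prod_type]
  rw [Finset.sum_eq_single i.1]
  · by_cases h : i.1 = j.1 <;> simp [h]
  · intro x _ hx
    simp [hx.symm]
  · simp

omit [Fintype X] [Fintype B] [DecidableEq B] in
lemma blockMat_conjTranspose (M : X → Matrix B B ℂ) :
    (blockMat M)ᴴ = blockMat fun x => (M x)ᴴ := by
  ext i j
  simp only [conjTranspose_apply, blockMat_apply]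
  by_cases h : i.1 = j.1
  · simp [h]
  · simp [h, Ne.symm h]

omit [Fintype X] [Fintype B] in
lemma blockMat_diagonal (d : X → B → ℂ) :
    blockMat (fun x => diagonal (d x)) = diagonal fun i => d i.1 i.2 := by
  ext i j
  rw [blockMat_apply, diagonal_apply, diagonal_apply]
  by_cases h : i.1 = j.1 <;> simp [Prod.ext_iff, h]

omit [Fintype X] [Fintype B] in
lemma blockMat_one : blockMat (fun _ : X => (1 : Matrix B B ℂ)) = 1 := by
  simp_rw [← diagonal_one]
  rw [blockMat_diagonal]

omit [DecidableEq B] in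
lemma blockMat_trace (M : X → Matrix B B ℂ) : (blockMat M).trace = ∑ x, (M x).trace := by
  simp [trace, blockMat_apply, Fintype.sum_prod_type]

omit [Fintype X] [Fintype B] [DecidableEq B] in
lemma blockMat_injective : Function.Injective (blockMat (X := X) (B := B)) := by
  intro M N h
  ext x i j
  have := congrFun (congrFun h (x, i)) (x, j)
  simpa [blockMat_apply] using this

lemma Diagonalizes.blockMat {U : X → Matrix B B ℂ} {d : X → B → ℝ} {M : X → Matrix B B ℂ}
    (h : ∀ x, Diagonalizes (U x) (d x) (M x)) :
    Diagonalizes (CQSW.blockMat U) (fun i => d i.1 i.2) (CQSW.blockMat M) where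
  star_mul := by simp_rw [blockMat_conjTranspose, blockMat_mul, (h _).star_mul, blockMat_one]
  mul_star := by simp_rw [blockMat_conjTranspose, blockMat_mul, (h _).mul_star, blockMat_one]
  eq := by
    rw [← blockMat_diagonal (fun x i => (d x i : ℂ)), blockMat_conjTranspose, blockMat_mul,
      blockMat_mul]
    congr 1
    ext1 x
    exact (h x).eq

lemma cfc_blockMat {M : X → Matrix B B ℂ} (hM : ∀ x, (M x).IsHermitian) (f : ℝ → ℝ) :
    cfc f (blockMat M) = blockMat fun x => cfc f (M x) := by
  have h := fun x => diagonalizes_eigenvectorUnitary (hM x)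
  rw [((Diagonalizes.blockMat h).cfc f).eq, (Diagonalizes.blockMat fun x => (h x).cfc f).eq]

lemma blockMat_posSemidef {M : X → Matrix B B ℂ} (hM : ∀ x, (M x).PosSemidef) :
    (blockMat M).PosSemidef :=
  (Diagonalizes.blockMat fun x => diagonalizes_eigenvectorUnitary (hM x).1).posSemidef fun i =>
    (diagonalizes_eigenvectorUnitary (hM i.1).1).nonneg (hM i.1) i.2

lemma matPow_blockMat {M : X → Matrix B B ℂ} (hM : ∀ x, (M x).PosSemidef) (s : ℝ) :
    matPow (blockMat M) s = blockMat fun x => matPow (M x) s :=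
  cfc_blockMat (fun x => (hM x).1) _

lemma sandwichedQ_blockMat {M N : X → Matrix B B ℂ} (hM : ∀ x, (M x).PosSemidef)
    (hN : ∀ x, (N x).PosSemidef) (α : ℝ) :
    sandwichedQ α (blockMat M) (blockMat N) = ∑ x, sandwichedQ α (M x) (N x) := by
  rw [sandwichedQ, matPow_blockMat hM, matPow_blockMat hN, blockMat_mul, blockMat_mul,
    matPow_blockMat fun x => sandwichedQ_inner_posSemidef (hM x) (hN x) _, blockMat_trace,
    Complex.re_sum]
  rfl

omit [Fintype X] [Fintype B] [DecidableEq B] in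
lemma one_kronecker_eq_blockMat (σ : Matrix B B ℂ) :
    (1 : Matrix X X ℂ) ⊗ₖ σ = blockMat fun _ => σ := by
  ext i j
  rw [kroneckerMap_apply, blockMat_apply, one_apply]
  split_ifs <;> simp

/-- The subnormalized state `p x • ρ x`. -/
def CQState.block (S : CQState X B) (x : X) : Matrix B B ℂ := (S.p x : ℂ) • S.state x

lemma CQState.toMatrix_eq_blockMat (S : CQState X B) : S.toMatrix = blockMat S.block := by
  ext i j
  rw [toMatrix, Matrix.sum_apply, blockMat_apply, Finset.sum_eq_single i.1]
  · by_cases h : i.1 = j.1 <;> simp [CQState.block, h]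
  · intro x _ hx
    simp [hx]
  · simp

omit [DecidableEq X] in
lemma CQState.block_posSemidef (S : CQState X B) (x : X) : (S.block x).PosSemidef :=
  (S.state_density x).1.smul (by exact_mod_cast S.p_nonneg x)

omit [DecidableEq X] in
lemma CQState.block_trace (S : CQState X B) (x : X) : (S.block x).trace = S.p x := by
  rw [CQState.block, trace_smul, (S.state_density x).2, smul_eq_mul, mul_one]

lemma CQState.toMatrix_density (S : CQState X B) : IsDensity S.toMatrix := by
  rw [S.toMatrix_eq_blockMat]
  refine ⟨blockMat_posSemidef S.block_posSemidef, ?_⟩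
  rw [blockMat_trace]
  simp_rw [S.block_trace]
  exact_mod_cast S.p_sum

end Block

/-! ### Tensor products and multiplicativity of `sandwichedQ` -/

section TensorPower

variable {B : Type*} [Fintype B] [DecidableEq B] {n : ℕ}

/-- The tensor product of the matrices `M k`, in the product basis. -/
def tensorMat (M : Fin n → Matrix B B ℂ) : Matrix (Fin n → B) (Fin n → B) ℂ :=
  of fun i j => ∏ k, M k (i k) (j k)

omit [DecidableEq B] in
lemma tensorMat_mul (M N : Fin n → Matrix B B ℂ) :
    tensorMat M * tensorMat N = tensorMat fun k => M k * N k := by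
  ext i j
  simp only [mul_apply, tensorMat, of_apply, ← Finset.prod_mul_distrib]
  rw [Finset.prod_univ_sum, Fintype.piFinset_univ]

omit [Fintype B] [DecidableEq B] in
lemma tensorMat_conjTranspose (M : Fin n → Matrix B B ℂ) :
    (tensorMat M)ᴴ = tensorMat fun k => (M k)ᴴ := by
  ext i j
  simp [tensorMat]

omit [Fintype B] in
lemma tensorMat_diagonal (d : Fin n → B → ℂ) :
    tensorMat (fun k => diagonal (d k)) = diagonal fun i => ∏ k, d k (i k) := by
  ext i j
  simp only [tensorMat, of_apply, diagonal_apply]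
  split_ifs with h
  · subst h; simp
  · obtain ⟨k, hk⟩ := Function.ne_iff.1 h
    exact Finset.prod_eq_zero (Finset.mem_univ k) (if_neg hk)

omit [Fintype B] in
lemma tensorMat_one : tensorMat (fun _ : Fin n => (1 : Matrix B B ℂ)) = 1 := by
  simp_rw [← diagonal_one]
  rw [tensorMat_diagonal]
  simp

omit [DecidableEq B] in
lemma tensorMat_trace (M : Fin n → Matrix B B ℂ) : (tensorMat M).trace = ∏ k, (M k).trace := by
  simp only [trace, diag_apply, tensorMat, of_apply]
  rw [Finset.prod_univ_sum, Fintype.piFinset_univ]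

lemma Diagonalizes.tensorMat {U : Fin n → Matrix B B ℂ} {d : Fin n → B → ℝ}
    {M : Fin n → Matrix B B ℂ} (h : ∀ k, Diagonalizes (U k) (d k) (M k)) :
    Diagonalizes (CQSW.tensorMat U) (fun i => ∏ k, d k (i k)) (CQSW.tensorMat M) where
  star_mul := by simp_rw [tensorMat_conjTranspose, tensorMat_mul, (h _).star_mul, tensorMat_one]
  mul_star := by simp_rw [tensorMat_conjTranspose, tensorMat_mul, (h _).mul_star, tensorMat_one]
  eq := by
    simp_rw [Complex.ofReal_prod]
    rw [← tensorMat_diagonal (fun k i => (d k i : ℂ)), tensorMat_conjTranspose, tensorMat_mul,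
      tensorMat_mul]
    congr 1
    ext1 k
    exact (h k).eq

/-- Eigenvalues of a tensor product are products, so powers commute with tensoring exactly because
the scalar function is multiplicative, including at zero. -/
lemma suppPow_prod (s : ℝ) {a : Fin n → ℝ} (ha : ∀ k, 0 ≤ a k) :
    suppPow s (∏ k, a k) = ∏ k, suppPow s (a k) := by
  unfold suppPow
  split_ifs with h
  · obtain ⟨k, hk, h0⟩ := Finset.prod_eq_zero_iff.1 h
    exact (Finset.prod_eq_zero (i := k) hk (by rw [if_pos h0])).symm
  · rw [← Real.finsetProd_rpow _ _ fun k _ => ha k]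
    have h' := Finset.prod_ne_zero_iff.1 h
    exact Finset.prod_congr rfl fun k hk => (if_neg (h' k hk)).symm

lemma tensorMat_posSemidef {M : Fin n → Matrix B B ℂ} (hM : ∀ k, (M k).PosSemidef) :
    (tensorMat M).PosSemidef :=
  (Diagonalizes.tensorMat fun k => diagonalizes_eigenvectorUnitary (hM k).1).posSemidef fun i =>
    Finset.prod_nonneg fun k _ =>
      (diagonalizes_eigenvectorUnitary (hM k).1).nonneg (hM k) (i k)

lemma matPow_tensorMat {M : Fin n → Matrix B B ℂ} (hM : ∀ k, (M k).PosSemidef) (s : ℝ) :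
    matPow (tensorMat M) s = tensorMat fun k => matPow (M k) s := by
  have h := fun k => diagonalizes_eigenvectorUnitary (hM k).1
  rw [((Diagonalizes.tensorMat h).matPow s).eq,
    (Diagonalizes.tensorMat fun k => (h k).matPow s).eq]
  simp_rw [suppPow_prod s fun k => (h k).nonneg (hM k) _]

lemma sandwichedQ_tensorMat {M N : Fin n → Matrix B B ℂ} (hM : ∀ k, (M k).PosSemidef)
    (hN : ∀ k, (N k).PosSemidef) (α : ℝ) :
    sandwichedQ α (tensorMat M) (tensorMat N) = ∏ k, sandwichedQ α (M k) (N k) := by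
  have h := fun k => sandwichedQ_inner_posSemidef (hM k) (hN k) ((1 - α) / α)
  rw [sandwichedQ, matPow_tensorMat hM, matPow_tensorMat hN, tensorMat_mul, tensorMat_mul,
    matPow_tensorMat h, tensorMat_trace]
  -- Each factor's trace is real, so the real part passes through the product.
  rw [Finset.prod_congr rfl fun k _ =>
    (ofReal_trace_re_of_posSemidef (matPow_posSemidef (h k) α)).symm, ← Complex.ofReal_prod, Complex.ofReal_re]
  rfl

end TensorPower

/-! ### The one-shot converse bound -/

section Converse

variable {X B : Type*} [Fintype X] [DecidableEq X] [Fintype B] [DecidableEq B]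

omit [DecidableEq X] in
lemma CQState.tensorMat_block (S : CQState X B) {n : ℕ} (x : Fin n → X) :
    tensorMat (fun k => S.block (x k)) = (S.seqProb x : ℂ) • S.seqState x := by
  ext i j
  simp [tensorMat, CQState.block, CQState.seqProb, CQState.seqState, Finset.prod_mul_distrib]

/-- The probability of correct decoding. -/
def successProb (S : CQState X B) {n M : ℕ} (C : Code X B n M) : ℝ :=
  ∑ x : Fin n → X, ∑ w : Fin M, C.enc x w * S.seqProb x * (C.dec w x * S.seqState x).trace.re

/-- The test associated with the source sequence `x`: encode, then decode to `x`. -/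
def Code.test {n M : ℕ} (C : Code X B n M) (x : Fin n → X) : Matrix (Fin n → B) (Fin n → B) ℂ :=
  ∑ w, (C.enc x w : ℂ) • C.dec w x

variable {n M : ℕ} (C : Code X B n M)

lemma Code.test_posSemidef (x : Fin n → X) : (C.test x).PosSemidef :=
  posSemidef_sum _ fun w _ => (C.dec_pos w x).smul (by exact_mod_cast C.enc_nonneg x w)

lemma Code.test_le_one (x : Fin n → X) (v : (Fin n → B) → ℂ) :
    quadForm (C.test x) v ≤ quadForm 1 v := by
  rw [Code.test, quadForm_sum]
  calc _ ≤ ∑ w, C.enc x w * quadForm 1 v := Finset.sum_le_sum fun w _ => by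
        rw [quadForm_smul, ← C.dec_sum w, quadForm_sum]
        exact mul_le_mul_of_nonneg_left (Finset.single_le_sum
          (f := fun y => quadForm (C.dec w y) v) (fun y _ => quadForm_nonneg (C.dec_pos w y) v)
          (Finset.mem_univ x)) (C.enc_nonneg x w)
    _ = _ := by rw [← Finset.sum_mul, C.enc_sum, one_mul]

/-- Bound each encoder probability by `1`; each of the `M` POVMs then contributes `Tr σ = 1`. This
is where the rate enters. -/
lemma Code.sum_trace_test_mul_le {σ : Matrix (Fin n → B) (Fin n → B) ℂ} (hσ : IsDensity σ) :
    ∑ x, (C.test x * σ).trace.re ≤ M := by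
  have h0 : ∀ x w, 0 ≤ (C.dec w x * σ).trace.re := fun x w =>
    trace_mul_re_nonneg (C.dec_pos w x) hσ.1
  calc ∑ x, (C.test x * σ).trace.re = ∑ x, ∑ w, C.enc x w * (C.dec w x * σ).trace.re := by
        simp [Code.test, Finset.sum_mul, trace_sum]
    _ ≤ ∑ x, ∑ w, (C.dec w x * σ).trace.re :=
        Finset.sum_le_sum fun x _ => Finset.sum_le_sum fun w _ =>
          mul_le_of_le_one_left (h0 x w) (by
            rw [← C.enc_sum x]
            exact Finset.single_le_sum (fun w _ => C.enc_nonneg x w) (Finset.mem_univ w))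
    _ = ∑ w : Fin M, (1 : ℝ) := by
        rw [Finset.sum_comm]
        refine Finset.sum_congr rfl fun w _ => ?_
        rw [← Complex.re_sum, ← trace_sum, ← Finset.sum_mul, C.dec_sum, one_mul, hσ.2,
          Complex.one_re]
    _ = M := by simp

lemma successProb_eq (S : CQState X B) :
    successProb S C = ∑ x, (C.test x * tensorMat fun k => S.block (x k)).trace.re := by
  refine Finset.sum_congr rfl fun x _ => ?_
  rw [S.tensorMat_block, Code.test, Finset.sum_mul, trace_sum, Complex.re_sum]
  refine Finset.sum_congr rfl fun w _ => ?_
  simp [mul_assoc, mul_left_comm]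

/-- The converse bound: every state `σ` of `B` bounds the probability of correct decoding. -/
lemma successProb_le (S : CQState X B) {σ : Matrix B B ℂ} (hσ : IsDensity σ)
    (hsupp : ∀ x, matPow σ 0 * S.block x = S.block x) {α : ℝ} (hα : 1 < α) :
    successProb S C ≤
      ((∑ x, sandwichedQ α (S.block x) σ) ^ n) ^ (1 / α) * (M : ℝ) ^ ((α - 1) / α) := by
  have hα0 : 0 < α := by linarith
  have hpq : α.HolderConjugate (α / (α - 1)) := Real.HolderConjugate.conjExponent hα
  set σn : Matrix (Fin n → B) (Fin n → B) ℂ := tensorMat fun _ => σ with hσn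
  have hσn1 : IsDensity σn := ⟨tensorMat_posSemidef fun _ => hσ.1, by
    rw [hσn, tensorMat_trace]; simp [hσ.2]⟩
  have hQ : ∀ x : Fin n → X, sandwichedQ α (tensorMat fun k => S.block (x k)) σn =
      ∏ k, sandwichedQ α (S.block (x k)) σ := fun x =>
    sandwichedQ_tensorMat (fun k => S.block_posSemidef _) (fun _ => hσ.1) α
  have hq0 : ∀ x, 0 ≤ sandwichedQ α (S.block x) σ := fun x =>
    sandwichedQ_nonneg (S.block_posSemidef x) hσ.1 α
  have hQ0 : ∀ x : Fin n → X, 0 ≤ ∏ k, sandwichedQ α (S.block (x k)) σ := fun x =>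
    Finset.prod_nonneg fun k _ => hq0 _
  have ht0 : ∀ x, 0 ≤ (C.test x * σn).trace.re := fun x =>
    trace_mul_re_nonneg (C.test_posSemidef x) hσn1.1
  have hx : ∀ x, (C.test x * tensorMat fun k => S.block (x k)).trace.re ≤
      (∏ k, sandwichedQ α (S.block (x k)) σ) ^ (1 / α) *
        (C.test x * σn).trace.re ^ ((α - 1) / α) := fun x => by
    rw [← hQ]
    refine trace_test_le (tensorMat_posSemidef fun k => S.block_posSemidef _) hσn1.1
      (C.test_posSemidef x) (C.test_le_one x) ?_ hα
    rw [hσn, matPow_tensorMat fun _ => hσ.1, tensorMat_mul]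
    simp_rw [hsupp]
  rw [successProb_eq]
  refine (Finset.sum_le_sum fun x _ => hx x).trans ?_
  -- Hölder over source sequences, with exponents `α` and `α / (α - 1)` undoing the powers in `hx`.
  refine (Real.inner_le_Lp_mul_Lq_of_nonneg Finset.univ hpq
    (fun x _ => Real.rpow_nonneg (hQ0 x) _) fun x _ => Real.rpow_nonneg (ht0 x) _).trans ?_
  simp_rw [← Real.rpow_mul (hQ0 _), ← Real.rpow_mul (ht0 _)]
  rw [one_div_mul_cancel hα0.ne', div_mul_div_cancel₀' (by linarith), div_self (by linarith),
    one_div_div]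
  simp_rw [Real.rpow_one]
  -- Single-letterization: a sum over sequences of products is the `n`-th power of the one-letter
  -- sum.
  rw [← Fintype.sum_pow fun x => sandwichedQ α (S.block x) σ]
  refine mul_le_mul_of_nonneg_left (Real.rpow_le_rpow (Finset.sum_nonneg fun x _ => ht0 x)
    (C.sum_trace_test_mul_le hσn1) (div_nonneg (by linarith) hα0.le)) ?_
  exact Real.rpow_nonneg (pow_nonneg (Finset.sum_nonneg fun x _ => hq0 x) _) _

end Converse

/-! ### The marginal dominates every block -/

section Domination

variable {A X B : Type*} [Fintype A] [DecidableEq A] [Fintype X] [DecidableEq X] [Fintype B]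
  [DecidableEq B]

-- If `σ v = 0`, then `0 ≤ ⟨v, ρ v⟩ ≤ ⟨v, σ v⟩ = 0`, which forces `ρ v = 0`.
omit [DecidableEq A] in
lemma suppLE_of_sub_posSemidef {ρ σ : Matrix A A ℂ} (hρ : ρ.PosSemidef)
    (h : (σ - ρ).PosSemidef) : SuppLE ρ σ := by
  intro v hv
  rw [LinearMap.mem_ker, mulVecLin_apply] at hv ⊢
  rw [← hρ.dotProduct_mulVec_zero_iff]
  have h1 := h.dotProduct_mulVec_nonneg v
  rw [sub_mulVec, hv, zero_sub, dotProduct_neg] at h1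
  exact le_antisymm (neg_nonneg.1 h1) (hρ.dotProduct_mulVec_nonneg v)

lemma IsDensity.one_sub_posSemidef {ρ : Matrix A A ℂ} (hρ : IsDensity ρ) :
    (1 - ρ).PosSemidef := by
  have h := diagonalizes_eigenvectorUnitary hρ.1.1
  have h1 : Diagonalizes (hρ.1.1.eigenvectorUnitary : Matrix A A ℂ)
      (fun i => 1 - hρ.1.1.eigenvalues i) (1 - ρ) := by
    refine ⟨h.star_mul, h.mul_star, ?_⟩
    simp_rw [Complex.ofReal_sub, Complex.ofReal_one]
    rw [← diagonal_sub, mul_sub, sub_mul, ← h.eq, diagonal_one, mul_one, h.mul_star]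
  refine h1.posSemidef fun i => sub_nonneg.2 ?_
  have hs : ∑ i, hρ.1.1.eigenvalues i = 1 := by
    have := hρ.2.symm.trans hρ.1.1.trace_eq_sum_eigenvalues
    rw [← Complex.ofReal_inj, Complex.ofReal_sum, Complex.ofReal_one]
    exact this.symm
  rw [← hs]
  exact Finset.single_le_sum (fun j _ => h.nonneg hρ.1 j) (Finset.mem_univ i)

omit [Fintype X] [Fintype B] [DecidableEq B] in
lemma blockMat_sub (M N : X → Matrix B B ℂ) :
    blockMat M - blockMat N = blockMat fun x => M x - N x := by
  ext i j
  simp only [Matrix.sub_apply, blockMat_apply]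
  split_ifs <;> simp

/-- The reduced state of `B`. -/
def CQState.marginal (S : CQState X B) : Matrix B B ℂ := ∑ x, S.block x

lemma CQState.traceFst_toMatrix (S : CQState X B) : traceFst S.toMatrix = S.marginal := by
  ext i j
  simp [traceFst, S.toMatrix_eq_blockMat, blockMat_apply, CQState.marginal, Matrix.sum_apply]

omit [DecidableEq X] in
lemma CQState.marginal_density (S : CQState X B) : IsDensity S.marginal := by
  refine ⟨posSemidef_sum _ fun x _ => S.block_posSemidef x, ?_⟩
  rw [CQState.marginal, trace_sum]
  simp_rw [S.block_trace]
  exact_mod_cast S.p_sum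

omit [DecidableEq X] in
lemma CQState.marginal_sub_block_posSemidef (S : CQState X B) (x : X) :
    (S.marginal - S.block x).PosSemidef := by
  classical
  rw [CQState.marginal, ← Finset.add_sum_erase _ _ (Finset.mem_univ x), add_sub_cancel_left]
  exact posSemidef_sum _ fun y _ => S.block_posSemidef y

lemma CQState.suppLE_marginal (S : CQState X B) :
    SuppLE S.toMatrix ((1 : Matrix X X ℂ) ⊗ₖ S.marginal) := by
  refine suppLE_of_sub_posSemidef S.toMatrix_density.1 ?_
  rw [S.toMatrix_eq_blockMat, one_kronecker_eq_blockMat, blockMat_sub]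
  exact blockMat_posSemidef S.marginal_sub_block_posSemidef

lemma CQState.supp_block (S : CQState X B) {σ : Matrix B B ℂ} (hσ : σ.PosSemidef)
    (h : SuppLE S.toMatrix ((1 : Matrix X X ℂ) ⊗ₖ σ)) (x : X) :
    matPow σ 0 * S.block x = S.block x := by
  rw [one_kronecker_eq_blockMat] at h
  have := supp_mul_of_suppLE S.toMatrix_density.1 (blockMat_posSemidef fun _ => hσ) h
  rw [matPow_blockMat fun _ => hσ, S.toMatrix_eq_blockMat, blockMat_mul] at this
  exact congrFun (blockMat_injective this) x

lemma CQState.sandwichedQ_eq_sum (S : CQState X B) {σ : Matrix B B ℂ} (hσ : σ.PosSemidef)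
    (α : ℝ) : sandwichedQ α S.toMatrix ((1 : Matrix X X ℂ) ⊗ₖ σ) =
      ∑ x, sandwichedQ α (S.block x) σ := by
  rw [S.toMatrix_eq_blockMat, one_kronecker_eq_blockMat,
    sandwichedQ_blockMat S.block_posSemidef fun _ => hσ]

end Domination

/-! ### Nonvanishing success and the exponent for fixed `σ` and `α` -/

section Achievable

variable {X B : Type*} [Fintype X] [DecidableEq X] [Fintype B] [DecidableEq B]

/-- The code with one message that always outputs the sequence `y`. -/
def Code.guess (B : Type*) [Fintype B] [DecidableEq B] {n : ℕ} (y : Fin n → X) :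
    Code X B n 1 where
  enc _ _ := 1
  dec _ x := if x = y then 1 else 0
  enc_nonneg _ _ := zero_le_one
  enc_sum _ := by simp
  dec_pos _ x := by
    split_ifs
    · exact PosSemidef.one
    · exact PosSemidef.zero
  dec_sum _ := by simp

lemma successProb_guess (S : CQState X B) {n : ℕ} (y : Fin n → X) :
    successProb S (Code.guess B y) = S.seqProb y := by
  have h : (S.seqState y).trace = 1 := by
    have := tensorMat_trace fun k => S.state (y k)
    rw [Finset.prod_eq_one fun k _ => (S.state_density (y k)).2] at this
    exact this
  rw [successProb, Finset.sum_eq_single y]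
  · simp [Code.guess, h]
  · intro x _ hx
    simp [Code.guess, hx]
  · simp

/-- Keeps the arguments of the logarithms positive, away from the default value of `Real.logb` at
zero. -/
lemma exists_successProb_pos (S : CQState X B) (n : ℕ) :
    ∃ C : Code X B n 1, 0 < successProb S C := by
  obtain ⟨a, ha⟩ : ∃ a, 0 < S.p a := by
    by_contra! h
    have := Finset.sum_nonpos fun x (_ : x ∈ Finset.univ) => h x
    rw [S.p_sum] at this
    linarith
  refine ⟨Code.guess B fun _ => a, ?_⟩
  rw [successProb_guess]
  exact Finset.prod_pos fun _ _ => ha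

lemma errorProb_eq (S : CQState X B) {n M : ℕ} (C : Code X B n M) :
    errorProb S C = 1 - successProb S C := rfl

/-- Were it zero, the converse bound at blocklength `1` would rule out the guessing code. -/
lemma sandwichedQ_pos (S : CQState X B) {σ : Matrix B B ℂ} (hσ : IsDensity σ)
    (h : SuppLE S.toMatrix ((1 : Matrix X X ℂ) ⊗ₖ σ)) {α : ℝ} (hα : 1 < α) :
    0 < sandwichedQ α S.toMatrix ((1 : Matrix X X ℂ) ⊗ₖ σ) := by
  obtain ⟨C, hC⟩ := exists_successProb_pos S 1
  have hle := hC.trans_le (successProb_le C S hσ (S.supp_block hσ.1 h) hα)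
  rw [S.sandwichedQ_eq_sum hσ.1]
  refine (Finset.sum_nonneg fun x _ =>
    sandwichedQ_nonneg (S.block_posSemidef x) hσ.1 α).lt_of_ne fun h0 => ?_
  rw [← h0, pow_one, Real.zero_rpow (one_div_ne_zero (by linarith)), zero_mul] at hle
  exact lt_irrefl _ hle

lemma scExponent_ge (S : CQState X B) {R : ℝ} (hR : 0 ≤ R) {n : ℕ} (hn : 1 ≤ n)
    {σ : Matrix B B ℂ} (hσ : IsDensity σ)
    (h : SuppLE S.toMatrix ((1 : Matrix X X ℂ) ⊗ₖ σ)) {α : ℝ} (hα : 1 < α) :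
    -(1 / α * Real.logb 2 (sandwichedQ α S.toMatrix ((1 : Matrix X X ℂ) ⊗ₖ σ))) -
      (α - 1) / α * R ≤ scExponent S n R := by
  have hα0 : 0 < α := by linarith
  have hγ : 0 ≤ (α - 1) / α := div_nonneg (by linarith) hα0.le
  have hn0 : (0 : ℝ) < n := by exact_mod_cast hn
  have hq := sandwichedQ_pos S hσ h hα
  set q := sandwichedQ α S.toMatrix ((1 : Matrix X X ℂ) ⊗ₖ σ) with hq_def
  set b : ℝ := (q ^ n) ^ (1 / α) * ((2 : ℝ) ^ ((n : ℝ) * R)) ^ ((α - 1) / α) with hb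
  have hsucc : ∀ (M : ℕ) (C : Code X B n M), (M : ℝ) ≤ (2 : ℝ) ^ ((n : ℝ) * R) →
      successProb S C ≤ b := fun M C hM => by
    refine (successProb_le C S hσ (S.supp_block hσ.1 h) hα).trans ?_
    rw [← S.sandwichedQ_eq_sum hσ.1, ← hq_def]
    exact mul_le_mul_of_nonneg_left (Real.rpow_le_rpow (Nat.cast_nonneg _) hM hγ) (by positivity)
  obtain ⟨C, hC⟩ := exists_successProb_pos S n
  have hone : ((1 : ℕ) : ℝ) ≤ (2 : ℝ) ^ ((n : ℝ) * R) := by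
    rw [Nat.cast_one]; exact Real.one_le_rpow one_le_two (by positivity)
  have hlow : ∀ e ∈ {e : ℝ | ∃ M : ℕ, (M : ℝ) ≤ (2 : ℝ) ^ ((n : ℝ) * R) ∧
      ∃ C : Code X B n M, e = errorProb S C}, 1 - b ≤ e := by
    rintro e ⟨M, hM, C, rfl⟩
    rw [errorProb_eq]
    linarith [hsucc M C hM]
  have hmem : errorProb S C ∈ {e : ℝ | ∃ M : ℕ, (M : ℝ) ≤ (2 : ℝ) ^ ((n : ℝ) * R) ∧
      ∃ C : Code X B n M, e = errorProb S C} := ⟨1, hone, C, rfl⟩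
  have h1 : 1 - b ≤ optError S n R := le_csInf ⟨_, hmem⟩ hlow
  -- A one-message code is admissible since `R ≥ 0`; this makes `1 - optError S n R` positive.
  have h2 : optError S n R ≤ errorProb S C := csInf_le ⟨_, hlow⟩ hmem
  rw [errorProb_eq] at h2
  have h3 : Real.logb 2 (1 - optError S n R) ≤ Real.logb 2 b :=
    Real.logb_le_logb_of_le one_lt_two (by linarith) (by linarith)
  have h4 : Real.logb 2 b = n * (1 / α * Real.logb 2 q + (α - 1) / α * R) := by
    rw [hb, Real.logb_mul (by positivity) (by positivity),
      Real.logb_rpow_eq_mul_logb_of_pos (by positivity), Real.logb_pow,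
      Real.logb_rpow_eq_mul_logb_of_pos (by positivity), Real.logb_rpow two_pos (by norm_num)]
    ring
  have h5 : 1 / (n : ℝ) * Real.logb 2 (1 - optError S n R) ≤
      1 / α * Real.logb 2 q + (α - 1) / α * R := by
    rw [one_div_mul_eq_div, div_le_iff₀' hn0, ← h4]
    exact h3
  rw [scExponent]
  linarith

end Achievable

/-! ### First-order expansion at `α = 1` -/

section Positivity

variable {A X B : Type*} [Fintype A] [DecidableEq A] [Fintype X] [DecidableEq X] [Fintype B]
  [DecidableEq B]

lemma hasDerivAt_suppPow {a : ℝ} (ha : 0 ≤ a) (s : ℝ) :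
    HasDerivAt (fun s => suppPow s a) (suppPow s a * Real.log a) s := by
  unfold suppPow
  split_ifs with h
  · simpa using hasDerivAt_const s (0 : ℝ)
  · exact (Real.hasStrictDerivAt_const_rpow (ha.lt_of_ne' h) s).hasDerivAt

/-- Only the exponent varies, so the eigenvalues are differentiated termwise to `a * log a`;
`Real.log 2` converts to base `2`. -/
lemma hasDerivAt_trace_matPow {M : Matrix A A ℂ} (hM : M.PosSemidef) :
    HasDerivAt (fun s => (matPow M s).trace.re) (-(Real.log 2 * vnEntropy M)) 1 := by
  have h0 := fun i => (diagonalizes_eigenvectorUnitary hM.1).nonneg hM i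
  simp_rw [matPow_eq_cfc, vnEntropy, trace_cfc_re hM.1]
  have := HasDerivAt.fun_sum (u := Finset.univ) fun i _ => hasDerivAt_suppPow (h0 i) 1
  refine this.congr_deriv ?_
  rw [Finset.mul_sum, ← Finset.sum_neg_distrib]
  refine Finset.sum_congr rfl fun i _ => ?_
  rw [suppPow_one, Real.logb]
  have : Real.log 2 ≠ 0 := (Real.log_pos one_lt_two).ne'
  field_simp

/-- The second factor has equal blocks, so the blocks of the state sum up to the marginal. -/
lemma CQState.trace_toMatrix_mul (S : CQState X B) {α : ℝ} :
    (S.toMatrix * matPow ((1 : Matrix X X ℂ) ⊗ₖ S.marginal) (1 - α)).trace.re =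
      (matPow S.marginal (2 - α)).trace.re := by
  have hm := S.marginal_density.1
  rw [S.toMatrix_eq_blockMat, one_kronecker_eq_blockMat, matPow_blockMat fun _ => hm,
    blockMat_mul, blockMat_trace, ← trace_sum, ← Finset.sum_mul]
  change (S.marginal * _).trace.re = _
  conv_lhs => enter [1, 1, 1]; rw [← matPow_one hm]
  rw [matPow_mul_matPow_eq hm (u := 2 - α) (by ring)]

/-- For a rate below the conditional entropy, some order `α > 1` has a Rényi conditional entropy
above the rate. -/
lemma exists_lt_neg_sandwiched (S : CQState X B) {R : ℝ} (hR : R < condEntropy S.toMatrix) :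
    ∃ α : ℝ, 1 < α ∧ R < -(1 / (α - 1) * Real.logb 2
      (sandwichedQ α S.toMatrix ((1 : Matrix X X ℂ) ⊗ₖ S.marginal))) := by
  have hρ := S.toMatrix_density
  have hm := S.marginal_density
  have hlog2 : 0 < Real.log 2 := Real.log_pos one_lt_two
  set F : ℝ → ℝ := fun α =>
    (matPow S.toMatrix α).trace.re + (matPow S.marginal (2 - α)).trace.re with hF
  have hd : HasDerivAt F (-(Real.log 2 * condEntropy S.toMatrix)) 1 := by
    have h2 : HasDerivAt (fun α : ℝ => (matPow S.marginal (2 - α)).trace.re)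
        (-(-(Real.log 2 * vnEntropy S.marginal))) 1 := by
      have h3 : HasDerivAt (fun α : ℝ => 2 - α) (-1) 1 := (hasDerivAt_id 1).const_sub 2
      have h4 : HasDerivAt (fun s => (matPow S.marginal s).trace.re)
          (-(Real.log 2 * vnEntropy S.marginal)) (2 - 1) := by
        rw [show (2 - 1 : ℝ) = 1 by norm_num]
        exact hasDerivAt_trace_matPow hm.1
      exact (h4.comp (1 : ℝ) h3).congr_deriv (by ring)
    refine ((hasDerivAt_trace_matPow hρ.1).add h2).congr_deriv ?_
    rw [condEntropy, S.traceFst_toMatrix]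
    ring
  have hF1 : F 1 = 2 := by
    simp only [hF]
    rw [show (2 - 1 : ℝ) = 1 by norm_num, matPow_one hρ.1, matPow_one hm.1, hρ.2, hm.2]
    norm_num
  have hlt : -(Real.log 2 * condEntropy S.toMatrix) < -(Real.log 2 * R) := by nlinarith
  -- Slopes of `F` near `1` lie below `-(Real.log 2 * R)`; approaching from the right supplies `α >
  -- 1`.
  have ht := (hasDerivAt_iff_tendsto_slope.1 hd).eventually_lt_const hlt
  have ht' := (ht.filter_mono (nhdsGT_le_nhdsNE (1 : ℝ))).and self_mem_nhdsWithin
  obtain ⟨α, hα1, hα⟩ := ht'.exists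
  have hα : 1 < α := hα
  have hα0 : 0 < α - 1 := by linarith
  refine ⟨α, hα, ?_⟩
  have hq := sandwichedQ_pos S hm S.suppLE_marginal hα
  have hle := sandwichedQ_le (σ := (1 : Matrix X X ℂ) ⊗ₖ S.marginal) hρ
    (by rw [one_kronecker_eq_blockMat]; exact blockMat_posSemidef fun _ => hm.1)
    (fun v => by
      rw [← sub_nonneg, ← quadForm_sub, one_kronecker_eq_blockMat, ← blockMat_one, blockMat_sub]
      exact quadForm_nonneg (blockMat_posSemidef fun _ => hm.one_sub_posSemidef) v)
    (supp_mul_of_suppLE hρ.1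
      (by rw [one_kronecker_eq_blockMat]; exact blockMat_posSemidef fun _ => hm.1)
      S.suppLE_marginal) hα
  rw [S.trace_toMatrix_mul] at hle
  rw [slope_def_field, hF1, div_lt_iff₀ hα0] at hα1
  simp only [hF] at hα1
  have hl := Real.log_le_sub_one_of_pos hq
  set q := sandwichedQ α S.toMatrix ((1 : Matrix X X ℂ) ⊗ₖ S.marginal)
  -- The chain is `log q ≤ q - 1 ≤ F α - 2 = F α - F 1`, bounded through the slope.
  have : Real.log q < -(Real.log 2 * R) * (α - 1) := by linarith
  rw [Real.logb, one_div_mul_eq_div, div_div, ← neg_div, lt_div_iff₀ (by positivity)]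
  linarith

end Positivity

/-! ### Negative multiples in the extended reals -/

section EReal

lemma ereal_mul_sub_le {c R h : ℝ} (hc : c < 0) {H : EReal} (hH : H ≤ h) :
    (c : EReal) * ((R : EReal) - H) ≤ ((c * (R - h) : ℝ) : EReal) := by
  induction H with
  | bot => simp [EReal.coe_mul_top_of_neg hc]
  | coe x =>
    have : x ≤ h := by exact_mod_cast hH
    rw [← EReal.coe_sub, ← EReal.coe_mul, EReal.coe_le_coe_iff]
    nlinarith
  | top => simp at hH

lemma ereal_mul_sub_pos {c R h : ℝ} (hc : c < 0) (hR : R < h) {H : EReal} (hH : (h : EReal) ≤ H) :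
    0 < (c : EReal) * ((R : EReal) - H) := by
  induction H with
  | bot => simp at hH
  | coe x =>
    have : h ≤ x := by exact_mod_cast hH
    rw [← EReal.coe_sub, ← EReal.coe_mul, EReal.coe_pos]
    nlinarith
  | top => simp [EReal.coe_mul_bot_of_neg hc]

end EReal

end CQSW

end

theorem theorem3 {X B : Type*} [Fintype X] [DecidableEq X] [Fintype B] [DecidableEq B]
    (S : CQSW.CQState X B) (R : ℝ) (hR₀ : 0 ≤ R) (hR : R < CQSW.condEntropy S.toMatrix)
    (n : ℕ) (hn : 1 ≤ n) :
    CQSW.scBound S R ≤ (CQSW.scExponent S n R : EReal) ∧ 0 < CQSW.scBound S R := by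
  have hneg : ∀ {α : ℝ}, 1 < α → (1 - α) / α < 0 := fun hα =>
    div_neg_of_neg_of_pos (by linarith) (by linarith)
  constructor
  · refine iSup_le fun ⟨α, hα⟩ => ?_
    have hα0 : α ≠ 0 := by linarith
    have hα1 : α - 1 ≠ 0 := by linarith
    -- `CQSW.scExponent_ge` solved for the entropy: the right side is free of `σ`, and is chosen so
    -- that `(1 - α) / α * (R - ·)` returns the exponent.
    have hH : CQSW.sandwichedCondEntropy α S.toMatrix ≤
        ((R + α / (α - 1) * CQSW.scExponent S n R : ℝ) : EReal) := by
      refine iSup_le fun ⟨σ, hσ⟩ => ?_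
      rw [CQSW.sandwichedD]
      split_ifs with h
      · rw [← EReal.coe_neg, EReal.coe_le_coe_iff]
        have h1 := CQSW.scExponent_ge S hR₀ hn hσ h hα
        have h2 := mul_le_mul_of_nonneg_left h1
          (div_nonneg (by linarith) (by linarith) : 0 ≤ α / (α - 1))
        have h3 : ∀ l : ℝ, α / (α - 1) * (-(1 / α * l) - (α - 1) / α * R) =
            -(1 / (α - 1) * l) - R := fun l => by field_simp
        rw [h3] at h2
        linarith
      -- Without support inclusion the divergence is `⊤`, so its negative is `⊥`.
      · simp
    refine (CQSW.ereal_mul_sub_le (hneg hα) hH).trans (le_of_eq ?_)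
    congr 1
    field_simp
    ring
  · obtain ⟨α, hα, h⟩ := CQSW.exists_lt_neg_sandwiched S hR
    refine lt_of_lt_of_le ?_ (le_iSup _ (⟨α, hα⟩ : {α : ℝ // 1 < α}))
    refine CQSW.ereal_mul_sub_pos (hneg hα) h ?_
    refine le_trans (le_of_eq ?_) (le_iSup _ ⟨S.marginal, S.marginal_density⟩)
    rw [CQSW.sandwichedD, if_pos S.suppLE_marginal, EReal.coe_neg]
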